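/- Let $\Sigma$ be a finite non-empty alphabet, $P$ a finite set of processes, and $\mathrm{loc}\colon\Sigma\to 2^P\setminus\{\emptyset\}$ a distribution of the letters; $(\Sigma,\mathrm{loc})$ is a distributed alphabet. Letters $a,b$ are independent if $\mathrm{loc}(a)\cap\mathrm{loc}(b)=\emptyset$, and for a word $u$ let $\mathrm{loc}(u)$ be the union of the sets $\mathrm{loc}(a)$ over the letters $a$ of $u$. The trace $[w]$ of a word $w=a_0\cdots a_{m-1}$ is the isomorphism class of the labelled partial order on the positions of $w$ generated by the pairs $i<j$ such that $a_i,a_j$ are not independent. A DFA $\mathcal A$ has a finite state set, one initial state, a set of final states, and at most one successor $\delta(q,a)$ for each state $q$ and letter $a$. It has the diamond property if, whenever $a,b$ are independent and $q\xrightarrow{a}q'\xrightarrow{b}q''$, there is a state $q'''$ with $q\xrightarrow{b}q'''\xrightarrow{a}q''$. For an integer $k\ge 1$ it is $k$-fair if $\mathrm{loc}(u)=P$ for every word $u$ with $|u|\ge k$ that labels a path from a state reachable from the initial state to a state from which a final state is reachable. An asynchronous automaton $\mathcal B$ over $(\Sigma,\mathrm{loc})$ has a set $Q_p$ of local states for each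 $p\in P$, a function $\delta_a\colon\prod_{p\in\mathrm{loc}(a)}Q_p\to\prod_{p\in\mathrm{loc}(a)}Q_p$ for each letter $a$, an initial global state in $\prod_{p\in P}Q_p$, and a set of final global states in $\prod_{p\in P}Q_p$. Reading $a$ applies $\delta_a$ to the components of the processes in $\mathrm{loc}(a)$ and leaves the others unchanged. It is finite if every $Q_p$ is finite. The trace language $L(\cdot)$ of either kind of automaton is the set of traces $[w]$ of the words $w$ that lead from its initial state to a final state. **Theorem.** There is an absolute constant $C$ such that for every distributed alphabet $(\Sigma,\mathrm{loc})$ as above, every integer $k\ge 1$ and every $k$-fair DFA $\mathcal A$ with $n$ states over $(\Sigma,\mathrm{loc})$ that has the diamond property, there is a finite asynchronous automaton $\mathcal B$ over $(\Sigma,\mathrm{loc})$ with $$L(\mathcal B)=L(\mathcal A)\qquad\text{and}\qquad |Q_p|\le C\cdot n\cdot k\cdot|\Sigma|^{3k-3}\quad\text{for every process }p\in P.$$ -/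

import Mathlib

universe u v w x

section Traces

variable {α : Type u}

/-- The causal order on the positions of the word `u`: the reflexive transitive closure of
"`i` is before `j` and the letters at `i` and `j` are dependent". -/
def causalLE (I : α → α → Prop) (u : List α) : Fin u.length → Fin u.length → Prop :=
  Relation.ReflTransGen fun i j => i < j ∧ ¬ I (u.get i) (u.get j)

/-- Two words are equivalent when they are linearisations of the same trace: there is a
bijection of their positions that preserves labels and the causal order, in both directions. -/
def TraceEquiv (I : α → α → Prop) (u v : List α) : Prop :=
  ∃ e : Fin u.length ≃ Fin v.length,
    (∀ i, v.get (e i) = u.get i) ∧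
    ∀ i j, causalLE I u i j ↔ causalLE I v (e i) (e j)

theorem traceEquiv_equivalence (I : α → α → Prop) : Equivalence (TraceEquiv I) where
  refl u := ⟨Equiv.refl _, fun _ => rfl, fun _ _ => Iff.rfl⟩
  symm := by
    rintro u v ⟨e, h1, h2⟩
    refine ⟨e.symm, fun i => ?_, fun i j => ?_⟩
    · have := h1 (e.symm i)
      rw [e.apply_symm_apply] at this
      exact this.symm
    · have := h2 (e.symm i) (e.symm j)
      rw [e.apply_symm_apply, e.apply_symm_apply] at this
      exact this.symm
  trans := by
    rintro u v w ⟨e, h1, h2⟩ ⟨f, g1, g2⟩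
    exact ⟨e.trans f, fun i => (g1 (e i)).trans (h1 i),
      fun i j => (h2 i j).trans (g2 (e i) (e j))⟩

/-- Equivalence of words over the concurrent alphabet with independence relation `I`. -/
def traceSetoid (I : α → α → Prop) : Setoid (List α) := ⟨TraceEquiv I, traceEquiv_equivalence I⟩

/-- Traces over the concurrent alphabet with independence relation `I`, as classes of words. -/
def Trace (I : α → α → Prop) : Type u := Quotient (traceSetoid I)

/-- The trace `[u]` of the word `u`. -/
def Trace.mk (I : α → α → Prop) (u : List α) : Trace I := Quotient.mk (traceSetoid I) u

/-- The set of traces of the words of a language. -/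
def traceLanguage (I : α → α → Prop) (L : Language α) : Set (Trace I) :=
  {t | ∃ u ∈ L, Trace.mk I u = t}

end Traces

section DistributedAlphabets

variable {α : Type u} {P : Type v}

/-- The independence relation of a distributed alphabet: no process reads both letters. -/
def Indep (loc : α → Set P) (a b : α) : Prop := Disjoint (loc a) (loc b)

/-- The set of processes that participate in the word `u`. -/
def locWord (loc : α → Set P) (u : List α) : Set P := ⋃ a ∈ u, loc a

end DistributedAlphabets

section Automata

variable {α : Type u} {P : Type v} {Q : Type w}

/-- A finite automaton is deterministic when it has exactly one initial state and each state has
at most one successor under each letter (transitions may be missing). -/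
def NFA.IsDeterministic (A : NFA α Q) : Prop :=
  (∃ q₀, A.start = {q₀}) ∧ ∀ q a, (A.step q a).Subsingleton

/-- The diamond property with respect to the independence relation `I`. -/
def NFA.Diamond (I : α → α → Prop) (A : NFA α Q) : Prop :=
  ∀ (q q' q'' : Q) (a b : α), I a b → q' ∈ A.step q a → q'' ∈ A.step q' b →
    ∃ q''' : Q, q''' ∈ A.step q b ∧ q'' ∈ A.step q''' a

/-- The state `q` can be reached from an initial state. -/
def NFA.IsReachable (A : NFA α Q) (q : Q) : Prop := ∃ u, q ∈ A.eval u

/-- A final state can be reached from the state `q`. -/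
def NFA.IsCoreachable (A : NFA α Q) (q : Q) : Prop := ∃ u, ∃ f ∈ A.accept, f ∈ A.evalFrom {q} u

/-- `k`-fairness: all processes participate in every word of length at least `k` that labels a
path from a reachable state to a co-reachable state. -/
def NFA.IsFair (loc : α → Set P) (k : ℕ) (A : NFA α Q) : Prop :=
  ∀ q, A.IsReachable q → ∀ u : List α, k ≤ u.length →
    ∀ q' ∈ A.evalFrom {q} u, A.IsCoreachable q' → locWord loc u = Set.univ

/-- A (deterministic) asynchronous automaton over the distributed alphabet given by `loc`. -/
structure AsyncAutomaton {α : Type u} {P : Type v} (loc : α → Set P) where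
  /-- The local states of each process. -/
  State : P → Type x
  /-- The transition functions, on the local states of the processes that read the letter. -/
  step : (a : α) → ((p : loc a) → State p) → ((p : loc a) → State p)
  /-- The initial global state. -/
  start : (p : P) → State p
  /-- The final global states. -/
  accept : Set ((p : P) → State p)

namespace AsyncAutomaton

variable {loc : α → Set P}

/-- An asynchronous automaton is finite when every process has finitely many local states. -/
def IsFinite (B : AsyncAutomaton.{u, v, x} loc) : Prop := ∀ p, Finite (B.State p)

open Classical in
/-- The deterministic automaton on global states that gives the semantics: a letter updates the
local states of the processes that read it, and leaves the other ones unchanged. -/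
noncomputable def toDFA (B : AsyncAutomaton.{u, v, x} loc) : DFA α ((p : P) → B.State p) where
  step s a := fun p => if h : p ∈ loc a then B.step a (fun r => s r) ⟨p, h⟩ else s p
  start := B.start
  accept := B.accept

end AsyncAutomaton

end Automata

/-! ### Words up to commutation, described by their projections to the processes -/

section Projections

variable {α : Type u} {P : Type v} {loc : α → Set P}

/-! What a process can know after a word is its view, the causal past of its last action, so its
local state must be a function of the view. By `exists_asyncAutomaton_of_code`, a code of views
gives an automaton as soon as the codes of the views joined by a letter determine the code of the
new view, and the codes of all views determine acceptance. The code used here consists of the last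
2(k-1) letters of the lexicographic normal form of the view, the state of A reached before them, and
the length, modulo 2k once it is large. All views that A cannot extend to acceptance share one code.

Fairness says that a suffix of a useful word that avoids some process has fewer than k letters.
Hence the normal form of a useful prefix of a trace agrees with that of the whole trace, except
perhaps in its last k-1 letters (`NFA.IsUseful.take_normalForm_eq`). Moreover, two useful views of
one word differ in length by less than k (`NFA.IsUseful.length_view_lt`), so residues modulo 2k
reveal the difference. To join views, remove the last k-1 letters from the normal form of the
shortest one: the rest is a common prefix of the normal forms of all views and of their join. Each
view continues it by at most 2(k-1) letters, which its code records, and these continuations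
determine that of the join (`suffixEquiv_view`).

Commutation is handled through projections alone. The two automata accept the same words, so
`TraceEquiv` need not be analysed. -/

open Classical in
/-- The subword of `u` of the letters that the process `p` reads. -/
noncomputable def proj (loc : α → Set P) (p : P) (u : List α) : List α :=
  u.filter fun a => p ∈ loc a

@[simp]
theorem proj_nil (p : P) : proj loc p [] = [] := rfl

@[simp]
theorem proj_append (p : P) (u v : List α) :
    proj loc p (u ++ v) = proj loc p u ++ proj loc p v := by
  simp [proj]

theorem proj_cons (p : P) (a : α) (u : List α) :
    proj loc p (a :: u) = proj loc p [a] ++ proj loc p u :=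
  proj_append p [a] u

theorem proj_singleton_of_mem {p : P} {a : α} (h : p ∈ loc a) : proj loc p [a] = [a] := by
  simp [proj, h]

theorem proj_singleton_of_notMem {p : P} {a : α} (h : p ∉ loc a) : proj loc p [a] = [] := by
  simp [proj, h]

theorem proj_eq_nil_iff {p : P} {u : List α} : proj loc p u = [] ↔ p ∉ locWord loc u := by
  simp [proj, locWord]

/-- Two words have the same projections. -/
def ProjEq (loc : α → Set P) (u v : List α) : Prop := ∀ p, proj loc p u = proj loc p v

/-- The projections of `u` are prefixes of those of `v`. -/
def ProjLE (loc : α → Set P) (u v : List α) : Prop := ∀ p, proj loc p u <+: proj loc p v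

theorem ProjEq.refl (u : List α) : ProjEq loc u u := fun _ => rfl

theorem ProjEq.symm {u v : List α} (h : ProjEq loc u v) : ProjEq loc v u := fun p => (h p).symm

theorem ProjEq.trans {u v w : List α} (h : ProjEq loc u v) (h' : ProjEq loc v w) :
    ProjEq loc u w := fun p => (h p).trans (h' p)

theorem ProjEq.append {u v u' v' : List α} (h : ProjEq loc u v) (h' : ProjEq loc u' v') :
    ProjEq loc (u ++ u') (v ++ v') := fun p => by simp [h p, h' p]

theorem ProjEq.append_left_cancel {u v v' : List α} (h : ProjEq loc (u ++ v) (u ++ v')) :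
    ProjEq loc v v' := fun p => by simpa using h p

theorem ProjEq.le {u v : List α} (h : ProjEq loc u v) : ProjLE loc u v :=
  fun p => (h p) ▸ List.prefix_refl _

theorem ProjLE.trans {u v w : List α} (h : ProjLE loc u v) (h' : ProjLE loc v w) :
    ProjLE loc u w := fun p => (h p).trans (h' p)

theorem projLE_append (u v : List α) : ProjLE loc u (u ++ v) := fun p => by simp

theorem projLE_nil (u : List α) : ProjLE loc [] u := fun p => by simp

open Classical in
theorem count_proj {p : P} {a : α} (h : p ∈ loc a) (u : List α) :
    (proj loc p u).count a = u.count a :=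
  List.count_filter (decide_eq_true h)

theorem ProjEq.perm (hloc : ∀ a, (loc a).Nonempty) {u v : List α} (h : ProjEq loc u v) :
    u.Perm v := by
  classical
  rw [List.perm_iff_count]
  intro a
  obtain ⟨p, hp⟩ := hloc a
  rw [← count_proj hp u, ← count_proj hp v, h p]

theorem ProjEq.length_eq (hloc : ∀ a, (loc a).Nonempty) {u v : List α} (h : ProjEq loc u v) :
    u.length = v.length := (h.perm hloc).length_eq

/-- A letter that comes first in all projections that contain it can be moved to the front. -/
theorem exists_minimal_occurrence (hloc : ∀ a, (loc a).Nonempty) {a : α} {v : List α}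
    (h : ∀ p ∈ loc a, [a] <+: proj loc p v) :
    ∃ l r, v = l ++ a :: r ∧ ∀ b ∈ l, Disjoint (loc a) (loc b) := by
  induction v with
  | nil =>
    obtain ⟨p, hp⟩ := hloc a
    simpa using h p hp
  | cons b v ih =>
    by_cases hab : a = b
    · exact ⟨[], v, by simp [hab], by simp⟩
    have hd : Disjoint (loc a) (loc b) := by
      rw [Set.disjoint_left]
      intro p hpa hpb
      have := h p hpa
      rw [proj_cons, proj_singleton_of_mem hpb] at this
      exact hab (by simpa using this)
    obtain ⟨l, r, rfl, hl⟩ := ih fun p hp => by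
      have := h p hp
      rwa [proj_cons, proj_singleton_of_notMem (Set.disjoint_left.1 hd hp), List.nil_append] at this
    exact ⟨b :: l, r, rfl, by simpa using ⟨hd, hl⟩⟩

theorem projEq_move_front {a : α} {l : List α} (r : List α)
    (hl : ∀ b ∈ l, Disjoint (loc a) (loc b)) : ProjEq loc (l ++ a :: r) (a :: (l ++ r)) := by
  intro p
  rw [proj_append, proj_cons p a r, proj_cons p a (l ++ r), proj_append]
  by_cases hp : p ∈ loc a
  · have : proj loc p l = [] := by
      rw [proj_eq_nil_iff]
      simp only [locWord, Set.mem_iUnion, not_exists]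
      exact fun b hb => Set.disjoint_left.1 (hl b hb) hp
    simp [this]
  · simp [proj_singleton_of_notMem hp]

/-- The letters of `u` can be pulled to the front of `v` one after the other; `y` is what is left.
-/
theorem ProjLE.exists_append (hloc : ∀ a, (loc a).Nonempty) {u v : List α} (h : ProjLE loc u v) :
    ∃ y, ProjEq loc v (u ++ y) := by
  induction u generalizing v with
  | nil => exact ⟨v, ProjEq.refl v⟩
  | cons a u ih =>
    obtain ⟨l, r, rfl, hl⟩ := exists_minimal_occurrence (v := v) hloc fun p hp => by
      have := h p
      rw [proj_cons, proj_singleton_of_mem hp] at this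
      exact (List.prefix_append _ _).trans this
    have hm := projEq_move_front r hl
    obtain ⟨y, hy⟩ := ih (v := l ++ r) fun p => by
      have := h p
      rwa [hm p, proj_cons, proj_cons p a (l ++ r), List.prefix_append_right_inj] at this
    exact ⟨y, hm.trans ((ProjEq.refl [a]).append hy)⟩

theorem ProjLE.length_le (hloc : ∀ a, (loc a).Nonempty) {u v : List α} (h : ProjLE loc u v) :
    u.length ≤ v.length := by
  obtain ⟨y, hy⟩ := h.exists_append hloc
  have := hy.length_eq hloc
  simp at this
  omega

/-- Two prefixes of a trace have a greatest common prefix. -/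
theorem exists_meet {s t w : List α} (hs : ProjLE loc s w) (ht : ProjLE loc t w) :
    ∃ m, ∀ p, proj loc p m <+: proj loc p s ∧ proj loc p m <+: proj loc p t ∧
      (proj loc p m = proj loc p s ∨ proj loc p m = proj loc p t) := by
  classical
  induction s using List.reverseRecOn with
  | nil => exact ⟨[], fun p => by simp⟩
  | append_singleton s e ih =>
    obtain ⟨m, hm⟩ := ih ((projLE_append s [e]).trans hs)
    by_cases he : ∀ p ∈ loc e, proj loc p s ++ [e] <+: proj loc p t
    · refine ⟨m ++ [e], fun p => ?_⟩
      obtain ⟨h1, h2, h3⟩ := hm p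
      by_cases hp : p ∈ loc e
      · have hms : proj loc p m = proj loc p s := by
          rcases h3 with h3 | h3
          · exact h3
          · have := (he p hp).length_le
            have := h1.length_le
            rw [h3] at this
            simp at *
            omega
        simp only [proj_append, proj_singleton_of_mem hp, hms]
        exact ⟨List.prefix_refl _, he p hp, Or.inl trivial⟩
      · simpa only [proj_append, proj_singleton_of_notMem hp, List.append_nil] using ⟨h1, h2, h3⟩
    · push Not at he
      obtain ⟨q, hq, hqt⟩ := he
      refine ⟨m, fun p => ?_⟩
      obtain ⟨h1, h2, h3⟩ := hm p
      refine ⟨h1.trans (projLE_append s [e] p), h2, ?_⟩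
      by_cases hp : p ∈ loc e
      · refine Or.inr ?_
        -- All processes of `e` agree on whether `t` contains this occurrence of `e`, because each
        -- of them sees every `e` and so counts the same number. If `q` does not find it in `t`, no
        -- other process does.
        have key : ∀ r ∈ loc e, proj loc r s ++ [e] <+: proj loc r t ∨
            proj loc r t <+: proj loc r s := by
          intro r hr
          have hsr := hs r
          rw [proj_append, proj_singleton_of_mem hr] at hsr
          rcases List.prefix_or_prefix_of_prefix hsr (ht r) with h | h
          · exact Or.inl h
          · rcases List.prefix_concat_iff.1 h with h | h
            · exact Or.inl (h ▸ List.prefix_refl _)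
            · exact Or.inr h
        have hts : proj loc p t <+: proj loc p s := by
          rcases key p hp with h | h
          · exfalso
            have hqs := (key q hq).resolve_left hqt
            have c1 := h.sublist.count_le e
            have c2 := hqs.sublist.count_le e
            rw [List.count_append, count_proj hp, count_proj hp] at c1
            rw [count_proj hq, count_proj hq] at c2
            simp at c1
            omega
          · exact h
        rcases h3 with h3 | h3
        · exact h2.eq_of_length_le (h3 ▸ hts.length_le)
        · exact h3
      · simpa only [proj_append, proj_singleton_of_notMem hp, List.append_nil] using h3

end Projections

/-! ### Lexicographic normal forms -/

section NormalForms

variable {α : Type u} {P : Type v} {loc : α → Set P}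

theorem List.cons_le_cons_iff_lex [LinearOrder α] {a b : α} {u v : List α} :
    a :: u ≤ b :: v ↔ a < b ∨ a = b ∧ u ≤ v := by
  rw [le_iff_lt_or_eq, le_iff_lt_or_eq, List.cons_lt_cons_iff]
  grind

theorem List.nil_le_lex [LinearOrder α] (v : List α) : [] ≤ v := by
  cases v with
  | nil => exact le_rfl
  | cons b v => exact le_of_lt List.Lex.nil

theorem List.append_le_append_iff_lex [LinearOrder α] (z : List α) {u v : List α} :
    z ++ u ≤ z ++ v ↔ u ≤ v := by
  induction z with
  | nil => rfl
  | cons a z ih => simp [List.cons_le_cons_iff_lex, ih]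

theorem List.take_le_take_of_le [LinearOrder α] {u v : List α} (h : u ≤ v) (i : ℕ) :
    u.take i ≤ v.take i := by
  induction i generalizing u v with
  | zero => simp
  | succ i ih =>
    cases u with
    | nil => exact List.nil_le_lex _
    | cons a u =>
      cases v with
      | nil => exact absurd h (not_le_of_gt List.Lex.nil)
      | cons b v =>
        rw [List.cons_le_cons_iff_lex] at h
        rw [List.take_succ_cons, List.take_succ_cons, List.cons_le_cons_iff_lex]
        exact h.imp_right fun h => ⟨h.1, ih h.2⟩

theorem exists_least_projEq [LinearOrder α] (hloc : ∀ a, (loc a).Nonempty) (u : List α) :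
    ∃ v, ProjEq loc u v ∧ ∀ v', ProjEq loc u v' → v ≤ v' := by
  have hfin : {v | ProjEq loc u v}.Finite :=
    (u.permutations.finite_toSet).subset fun v hv =>
      List.mem_permutations.2 (hv.perm hloc).symm
  obtain ⟨v, hv, hmin⟩ := Set.exists_min_image _ id hfin ⟨u, ProjEq.refl u⟩
  exact ⟨v, hv, hmin⟩

open Classical in
/-- The lexicographically least word with the same projections as `u`. -/
noncomputable def normalForm [LinearOrder α] (loc : α → Set P) (u : List α) : List α :=
  if h : ∃ v, ProjEq loc u v ∧ ∀ v', ProjEq loc u v' → v ≤ v' then h.choose else u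

variable [LinearOrder α] (hloc : ∀ a, (loc a).Nonempty)

include hloc

theorem projEq_normalForm (u : List α) : ProjEq loc u (normalForm loc u) := by
  have h := exists_least_projEq hloc u
  rw [normalForm, dif_pos h]
  exact h.choose_spec.1

theorem normalForm_le {u v : List α} (huv : ProjEq loc u v) : normalForm loc u ≤ v := by
  have h := exists_least_projEq hloc u
  rw [normalForm, dif_pos h]
  exact h.choose_spec.2 v huv

theorem ProjEq.normalForm_eq {u v : List α} (h : ProjEq loc u v) :
    normalForm loc u = normalForm loc v :=
  le_antisymm (normalForm_le hloc (h.trans (projEq_normalForm hloc v)))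
    (normalForm_le hloc (h.symm.trans (projEq_normalForm hloc u)))

@[simp]
theorem length_normalForm (u : List α) : (normalForm loc u).length = u.length :=
  ((projEq_normalForm hloc u).length_eq hloc).symm

theorem projEq_of_normalForm_eq_append {u z y : List α} (h : normalForm loc u = z ++ y) :
    ProjEq loc u (z ++ y) := h ▸ projEq_normalForm hloc u

/-- Suffixes of normal forms are normal forms. -/
theorem normalForm_suffix {u z y : List α} (h : normalForm loc u = z ++ y) :
    normalForm loc y = y := by
  refine le_antisymm (normalForm_le hloc (ProjEq.refl y)) ?_
  have := normalForm_le hloc ((projEq_of_normalForm_eq_append hloc h).trans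
    ((ProjEq.refl z).append (projEq_normalForm hloc y)))
  rwa [h, List.append_le_append_iff_lex] at this

/-- Suffixes of normal forms are themselves normal, so equality up to commutation becomes equality
of words. -/
theorem eq_of_normalForm_eq_append {u u' z z' y y' : List α} (h : normalForm loc u = z ++ y)
    (h' : normalForm loc u' = z' ++ y') (hy : ProjEq loc y y') : y = y' := by
  rw [← normalForm_suffix hloc h, ← normalForm_suffix hloc h', hy.normalForm_eq hloc]

/-- Normal forms of prefixes of a trace agree as long as the normal form of the whole trace stays
inside the prefix. -/
theorem take_normalForm_eq {s t : List α} (hst : ProjLE loc s t) {i : ℕ}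
    (hi : ProjLE loc ((normalForm loc t).take i) s) :
    (normalForm loc t).take i = (normalForm loc s).take i := by
  obtain ⟨y, hy⟩ := hst.exists_append hloc
  obtain ⟨y', hy'⟩ := hi.exists_append hloc
  have hle : s.length ≤ t.length := hst.length_le hloc
  rcases le_or_gt i s.length with his | his
  -- Minimality is used twice: `normalForm loc s ++ y` competes with the normal form of `t`, and
  -- `(normalForm loc t).take i ++ y'` with that of `s`.
  · refine le_antisymm ?_ ?_
    · have := List.take_le_take_of_le (normalForm_le hloc
        (hy.trans ((projEq_normalForm hloc s).append (ProjEq.refl y)))) i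
      rwa [List.take_append_of_le_length (by simpa [hloc] using his)] at this
    · have := List.take_le_take_of_le (normalForm_le hloc hy') i
      have hlen : ((normalForm loc t).take i).length = i := by
        simp [hloc]; omega
      rwa [List.take_append_of_le_length hlen.ge, List.take_of_length_le hlen.le] at this
  · have hlen := hi.length_le hloc
    rw [List.length_take, length_normalForm hloc] at hlen
    have h2 : t.length = s.length := by omega
    have h3 : y = [] := by
      have := hy.length_eq hloc
      simp at this
      exact List.eq_nil_of_length_eq_zero (by omega)
    subst h3
    rw [hy.normalForm_eq hloc, List.append_nil]

end NormalForms

/-! ### Views -/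

section Views

variable {α : Type u} {P : Type v} {loc : α → Set P}

open Classical in
/-- The view, on the reversal of a word. -/
noncomputable def viewReverse (loc : α → Set P) : Set P → List α → List α
  | _, [] => []
  | S, a :: w => if Disjoint (loc a) S then viewReverse loc S w
      else viewReverse loc (S ∪ loc a) w ++ [a]

/-- The causal past of the processes of `S` after the word `w`. -/
noncomputable def view (loc : α → Set P) (S : Set P) (w : List α) : List α :=
  viewReverse loc S w.reverse

@[simp]
theorem view_nil (S : Set P) : view loc S [] = [] := rfl

theorem view_concat_of_disjoint {S : Set P} {a : α} (h : Disjoint (loc a) S) (w : List α) :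
    view loc S (w ++ [a]) = view loc S w := by
  simp [view, viewReverse, h]

theorem view_concat {S : Set P} {a : α} (h : ¬ Disjoint (loc a) S) (w : List α) :
    view loc S (w ++ [a]) = view loc (S ∪ loc a) w ++ [a] := by
  simp [view, viewReverse, h]

theorem view_singleton_concat {p : P} {a : α} (h : p ∈ loc a) (w : List α) :
    view loc {p} (w ++ [a]) = view loc (loc a) w ++ [a] := by
  rw [view_concat (by simpa using h), Set.singleton_union, Set.insert_eq_of_mem h]

theorem view_singleton_concat_of_notMem {p : P} {a : α} (h : p ∉ loc a) (w : List α) :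
    view loc {p} (w ++ [a]) = view loc {p} w :=
  view_concat_of_disjoint (by simpa using h) w

theorem proj_view_of_mem {S : Set P} {p : P} (hp : p ∈ S) (w : List α) :
    proj loc p (view loc S w) = proj loc p w := by
  induction w using List.reverseRecOn generalizing S with
  | nil => rfl
  | append_singleton w a ih =>
    by_cases hS : Disjoint (loc a) S
    · rw [view_concat_of_disjoint hS, ih hp, proj_append,
        proj_singleton_of_notMem (Set.disjoint_right.1 hS hp), List.append_nil]
    · rw [view_concat hS, proj_append, ih (Or.inl hp), proj_append]

theorem view_mono {S T : Set P} (h : S ⊆ T) (w : List α) :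
    ProjLE loc (view loc S w) (view loc T w) := by
  induction w using List.reverseRecOn generalizing S T with
  | nil => exact projLE_nil _
  | append_singleton w a ih =>
    by_cases hT : Disjoint (loc a) T
    · rw [view_concat_of_disjoint hT, view_concat_of_disjoint (hT.mono_right h)]
      exact ih h
    · rw [view_concat hT]
      by_cases hS : Disjoint (loc a) S
      · rw [view_concat_of_disjoint hS]
        exact (ih (h.trans Set.subset_union_left)).trans (projLE_append _ _)
      · rw [view_concat hS]
        have hST : S ∪ loc a ⊆ T ∪ loc a := Set.union_subset_union_left _ h
        intro p
        by_cases hp : p ∈ loc a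
        · rw [proj_append, proj_append, proj_view_of_mem (Set.mem_union_right _ hp),
            proj_view_of_mem (Set.mem_union_right _ hp)]
        · simpa [proj_singleton_of_notMem hp] using ih hST p

theorem view_univ (w : List α) : ProjEq loc (view loc Set.univ w) w :=
  fun p => proj_view_of_mem (Set.mem_univ p) w

theorem view_le (S : Set P) (w : List α) : ProjLE loc (view loc S w) w :=
  (view_mono (Set.subset_univ S) w).trans (view_univ w).le

/-- The view of a set of processes is the join of the views of its elements. -/
theorem exists_proj_view_eq {S : Set P} (hS : S.Nonempty) (w : List α) (r : P) :
    ∃ p ∈ S, proj loc r (view loc S w) = proj loc r (view loc {p} w) := by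
  induction w using List.reverseRecOn generalizing S with
  | nil => exact hS.imp fun p hp => ⟨hp, rfl⟩
  | append_singleton w a ih =>
    by_cases hd : Disjoint (loc a) S
    · obtain ⟨p, hp, h⟩ := ih hS
      exact ⟨p, hp, by rw [view_concat_of_disjoint hd, h,
        view_singleton_concat_of_notMem (Set.disjoint_right.1 hd hp)]⟩
    · obtain ⟨q, hqa, hqS⟩ := Set.not_disjoint_iff.1 hd
      obtain ⟨p, hp, h⟩ := ih (hS.mono (Set.subset_union_left (t := loc a)))
      rw [view_concat hd]
      by_cases hra : r ∈ loc a
      · refine ⟨q, hqS, ?_⟩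
        rw [view_singleton_concat hqa, proj_append, proj_append, proj_view_of_mem (Set.mem_union_right _ hra),
          proj_view_of_mem hra]
      · rw [proj_append, proj_singleton_of_notMem hra, List.append_nil]
        -- The process `p` found before `a` may lie outside `S`. Then it takes part in `a`, and `q`,
        -- which belongs to `S` and reads `a`, inherits its view.
        by_cases hpa : p ∈ loc a
        · refine ⟨q, hqS, ?_⟩
          rw [view_singleton_concat hqa, proj_append, proj_singleton_of_notMem hra,
            List.append_nil]
          have h1 := view_mono (loc := loc) (Set.singleton_subset_iff.2 hpa) w r
          have h2 := view_mono (loc := loc) (Set.subset_union_right (s := S) (t := loc a)) w r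
          exact (h2.eq_of_length_le (h ▸ h1.length_le)).symm
        · refine ⟨p, hp.resolve_right hpa, ?_⟩
          rw [view_singleton_concat_of_notMem hpa, h]

end Views

/-! ### Fair automata with the diamond property -/

section FairAutomata

variable {α : Type u} {P : Type v} {Q : Type w} {loc : α → Set P} {A : NFA α Q}

/-- The word `u` labels a path from an initial state to a co-reachable state. -/
def NFA.IsUseful (A : NFA α Q) (u : List α) : Prop := ∃ q ∈ A.eval u, A.IsCoreachable q

theorem NFA.eval_append_word (A : NFA α Q) (u v : List α) :
    A.eval (u ++ v) = A.evalFrom (A.eval u) v :=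
  A.evalFrom_append _ u v

theorem NFA.stepSet_comm (hA : A.Diamond (Indep loc)) {a b : α} (h : Disjoint (loc a) (loc b))
    (S : Set Q) : A.stepSet (A.stepSet S a) b = A.stepSet (A.stepSet S b) a := by
  have key : ∀ a b : α, Disjoint (loc a) (loc b) →
      A.stepSet (A.stepSet S a) b ⊆ A.stepSet (A.stepSet S b) a := by
    intro a b h q'' hq''
    obtain ⟨q', hq', h2⟩ := NFA.mem_stepSet.1 hq''
    obtain ⟨q, hq, h1⟩ := NFA.mem_stepSet.1 hq'
    obtain ⟨q₃, h3, h4⟩ := hA q q' q'' a b h h1 h2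
    exact NFA.mem_stepSet.2 ⟨q₃, NFA.mem_stepSet.2 ⟨q, hq, h3⟩, h4⟩
  exact (key a b h).antisymm (key b a h.symm)

theorem NFA.evalFrom_move_front (hA : A.Diamond (Indep loc)) {a : α} {l : List α} (r : List α)
    (hl : ∀ b ∈ l, Disjoint (loc a) (loc b)) (S : Set Q) :
    A.evalFrom S (l ++ a :: r) = A.evalFrom S (a :: (l ++ r)) := by
  induction l generalizing S with
  | nil => rfl
  | cons b l ih =>
    have hab : Disjoint (loc a) (loc b) := hl b (by simp)
    rw [List.cons_append, NFA.evalFrom_cons, ih fun c hc => hl c (by simp [hc])]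
    simp [NFA.stepSet_comm hA hab]

/-- Equal projections allow one word to be rearranged into the other by swapping adjacent
independent letters, and the diamond property makes each swap harmless. -/
theorem ProjEq.evalFrom_eq (hloc : ∀ a, (loc a).Nonempty) (hA : A.Diamond (Indep loc))
    {u v : List α} (h : ProjEq loc u v) (S : Set Q) : A.evalFrom S u = A.evalFrom S v := by
  induction u generalizing v S with
  | nil =>
    have := h.length_eq hloc
    rw [List.eq_nil_of_length_eq_zero this.symm]
  | cons a u ih =>
    obtain ⟨l, r, rfl, hl⟩ := exists_minimal_occurrence (v := v) hloc fun p hp => by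
      rw [← h p, proj_cons, proj_singleton_of_mem hp]
      exact List.prefix_append _ _
    rw [NFA.evalFrom_move_front hA r hl, NFA.evalFrom_cons, NFA.evalFrom_cons]
    exact ih (ProjEq.append_left_cancel (u := [a]) (h.trans (projEq_move_front r hl))) _

theorem ProjEq.eval_eq (hloc : ∀ a, (loc a).Nonempty) (hA : A.Diamond (Indep loc))
    {u v : List α} (h : ProjEq loc u v) : A.eval u = A.eval v :=
  h.evalFrom_eq hloc hA _

theorem NFA.isUseful_congr {u v : List α} (h : A.eval u = A.eval v) :
    A.IsUseful u ↔ A.IsUseful v := by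
  simp [NFA.IsUseful, h]

theorem NFA.IsUseful.of_append {u v : List α} (h : A.IsUseful (u ++ v)) : A.IsUseful u := by
  obtain ⟨q, hq, x, f, hf, hx⟩ := h
  rw [NFA.eval_append_word] at hq
  obtain ⟨q', hq', hv⟩ := NFA.mem_evalFrom_iff_exists.1 hq
  refine ⟨q', hq', v ++ x, f, hf, ?_⟩
  rw [NFA.evalFrom_append]
  exact NFA.mem_evalFrom_iff_exists.2 ⟨q, hv, hx⟩

theorem NFA.IsUseful.of_le (hloc : ∀ a, (loc a).Nonempty) (hA : A.Diamond (Indep loc))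
    {u v : List α} (h : A.IsUseful v) (huv : ProjLE loc u v) : A.IsUseful u := by
  obtain ⟨y, hy⟩ := huv.exists_append hloc
  exact ((NFA.isUseful_congr (hy.eval_eq hloc hA)).1 h).of_append

theorem NFA.isUseful_of_mem_accepts {u : List α} (h : u ∈ A.accepts) : A.IsUseful u := by
  obtain ⟨f, hf, hu⟩ := h
  exact ⟨f, hu, [], f, hf, rfl⟩

/-- The form in which fairness is used throughout. -/
theorem NFA.IsUseful.length_lt {k : ℕ} (hfair : A.IsFair loc k) {u v : List α}
    (h : A.IsUseful (u ++ v)) {r : P} (hr : proj loc r v = []) : v.length < k := by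
  by_contra! hk
  obtain ⟨q, hq, hco⟩ := h
  rw [NFA.eval_append_word] at hq
  obtain ⟨q', hq', hv⟩ := NFA.mem_evalFrom_iff_exists.1 hq
  have := hfair q' ⟨u, hq'⟩ v hk q hv hco
  rw [proj_eq_nil_iff, this] at hr
  exact hr (Set.mem_univ r)

section

variable (hloc : ∀ a, (loc a).Nonempty) (hA : A.Diamond (Indep loc)) {k : ℕ}
  (hfair : A.IsFair loc k)

include hloc hA hfair

/-- All but the last `k - 1` letters of a useful prefix of a trace can be read off from
any linearisation of the trace. -/
theorem NFA.IsUseful.take_le {s t : List α} (hs : A.IsUseful s) (hst : ProjLE loc s t) {i : ℕ}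
    (hi : i ≤ s.length - (k - 1)) : ProjLE loc (t.take i) s := by
  induction i with
  | zero => exact projLE_nil _
  | succ i ih =>
    have hx := ih (by omega)
    have hlen := hst.length_le hloc
    have hit : i < t.length := by omega
    rw [← List.take_append_getElem hit]
    set e := t[i]
    by_contra hne
    simp only [ProjLE, not_forall] at hne
    obtain ⟨r, hr⟩ := hne
    have hre : r ∈ loc e := by
      by_contra hre
      exact hr (by simpa [proj_singleton_of_notMem hre] using hx r)
    obtain ⟨y, hy⟩ := hx.exists_append hloc
    have hsr : proj loc r s = proj loc r (t.take i) := by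
      have h1 : proj loc r (t.take i ++ [e]) <+: proj loc r t := by
        have := projLE_append (loc := loc) (t.take (i + 1)) (t.drop (i + 1)) r
        rwa [List.take_append_drop, ← List.take_append_getElem hit] at this
      rcases List.prefix_or_prefix_of_prefix h1 (hst r) with h | h
      · exact absurd h hr
      · rw [proj_append, proj_singleton_of_mem hre] at h
        rcases List.prefix_concat_iff.1 h with h | h
        · exact absurd (by rw [h, proj_append, proj_singleton_of_mem hre]) hr
        · exact h.eq_of_length_le (hx r).length_le
    have hyr : proj loc r y = [] := by
      have := hy r
      rw [hsr, proj_append] at this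
      simpa using this
    have := ((NFA.isUseful_congr (hy.eval_eq hloc hA)).1 hs).length_lt hfair hyr
    have hl := hy.length_eq hloc
    rw [List.length_append, List.length_take] at hl
    omega

theorem NFA.IsUseful.take_normalForm_eq [LinearOrder α] {s t : List α} (hs : A.IsUseful s)
    (hst : ProjLE loc s t) {i : ℕ} (hi : i ≤ s.length - (k - 1)) :
    (normalForm loc t).take i = (normalForm loc s).take i :=
  _root_.take_normalForm_eq hloc hst
    (hs.take_le hloc hA hfair (hst.trans (projEq_normalForm hloc t).le) hi)

/-- A useful view is less than `k` letters longer than any other view. -/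
theorem NFA.IsUseful.length_view_lt {w : List α} {p r : P} (hp : A.IsUseful (view loc {p} w)) :
    (view loc {p} w).length < (view loc {r} w).length + k := by
  obtain ⟨m, hm⟩ := exists_meet (view_le (loc := loc) {p} w) (view_le {r} w)
  have hmp : ProjLE loc m (view loc {p} w) := fun q => (hm q).1
  have hmr : ProjLE loc m (view loc {r} w) := fun q => (hm q).2.1
  obtain ⟨y, hy⟩ := hmp.exists_append hloc
  -- The view of `r` contains all `r`-letters of `w`, so the meet loses none of those in the view of
  -- `p`.
  have hyr : proj loc r y = [] := by
    have h1 : proj loc r (view loc {p} w) = proj loc r m := by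
      rcases (hm r).2.2 with h | h
      · exact h.symm
      · refine (hmp r).eq_of_length_le ?_ |>.symm
        rw [h, proj_view_of_mem (Set.mem_singleton r)]
        exact (view_le {p} w r).length_le
    have := hy r
    rw [h1, proj_append] at this
    simpa using this
  have h1 := ((NFA.isUseful_congr (hy.eval_eq hloc hA)).1 hp).length_lt hfair hyr
  have h2 := hy.length_eq hloc
  have h3 := hmr.length_le hloc
  rw [List.length_append] at h2
  omega

end

/-! ### Traces that agree up to a long prefix -/

/-- The normal forms of `s` and `t` share a long suffix, and the remaining prefixes
lead to the same states and have the same length modulo `2 * k`. -/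
def SuffixEquiv [LinearOrder α] (loc : α → Set P) (A : NFA α Q) (k : ℕ) (s t : List α) : Prop :=
  ∃ z z' y, normalForm loc s = z ++ y ∧ normalForm loc t = z' ++ y ∧ A.eval z = A.eval z' ∧
    (z = [] ∧ z' = [] ∨
      2 * (k - 1) ≤ y.length ∧ z.length % (2 * k) = z'.length % (2 * k))

variable [LinearOrder α] {k : ℕ}

theorem SuffixEquiv.eval_append_eq (hloc : ∀ a, (loc a).Nonempty) (hA : A.Diamond (Indep loc))
    {s t : List α} (h : SuffixEquiv loc A k s t) (v : List α) :
    A.eval (s ++ v) = A.eval (t ++ v) := by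
  obtain ⟨z, z', y, hs, ht, hz, -⟩ := h
  rw [NFA.eval_append_word, NFA.eval_append_word,
    (projEq_of_normalForm_eq_append hloc hs).eval_eq hloc hA,
    (projEq_of_normalForm_eq_append hloc ht).eval_eq hloc hA,
    NFA.eval_append_word, NFA.eval_append_word, hz]

theorem SuffixEquiv.eval_eq (hloc : ∀ a, (loc a).Nonempty) (hA : A.Diamond (Indep loc))
    {s t : List α} (h : SuffixEquiv loc A k s t) : A.eval s = A.eval t := by
  simpa using h.eval_append_eq hloc hA []

theorem SuffixEquiv.length_mod_eq (hloc : ∀ a, (loc a).Nonempty) {s t : List α}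
    (h : SuffixEquiv loc A k s t) : s.length % (2 * k) = t.length % (2 * k) := by
  obtain ⟨z, z', y, hs, ht, -, h⟩ := h
  rw [← length_normalForm hloc s, ← length_normalForm hloc t, hs, ht]
  rcases h with ⟨rfl, rfl⟩ | ⟨-, h⟩
  · rfl
  · rw [List.length_append, List.length_append, Nat.add_mod, h, ← Nat.add_mod]

/-- Short suffixes of the same length of the normal forms coincide. -/
theorem SuffixEquiv.suffix_eq {s t : List α} (h : SuffixEquiv loc A k s t)
    {x x' y y' : List α} (hs : normalForm loc s = x ++ y) (ht : normalForm loc t = x' ++ y')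
    (hlen : y.length = y'.length) (hy : y.length ≤ 2 * (k - 1)) : y = y' := by
  obtain ⟨z, z', d, hzs, hzt, -, hd⟩ := h
  have hyd : y <:+ z ++ d := hzs ▸ hs ▸ List.suffix_append x y
  have hyd' : y' <:+ z' ++ d := hzt ▸ ht ▸ List.suffix_append x' y'
  have key : ∃ e, y <:+ e ∧ y' <:+ e := by
    rcases hd with ⟨rfl, rfl⟩ | ⟨hd, -⟩
    · exact ⟨_, hyd, hyd'⟩
    · exact ⟨d, List.suffix_of_suffix_length_le hyd (List.suffix_append _ _) (by omega),
        List.suffix_of_suffix_length_le hyd' (List.suffix_append _ _) (by omega)⟩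
  obtain ⟨e, he, he'⟩ := key
  exact (List.suffix_of_suffix_length_le he he' hlen.le).eq_of_length hlen

/-- Each projection of the join comes from a single view, whose continuation `u` is the same for `w`
and `w'`. Exchanging `w` and `w'` gives the converse. -/
theorem proj_join_prefix (hloc : ∀ a, (loc a).Nonempty) {S : Set P} (hS : S.Nonempty)
    {w w' z z' x x' : List α} (hx : normalForm loc (view loc S w) = z ++ x)
    (hx' : normalForm loc (view loc S w') = z' ++ x')
    (h : ∀ p ∈ S, ∃ u, normalForm loc (view loc {p} w) = z ++ u ∧
      normalForm loc (view loc {p} w') = z' ++ u) : ProjLE loc x x' := by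
  intro r
  obtain ⟨p, hpS, hr⟩ := exists_proj_view_eq hS w r
  obtain ⟨u, hu, hu'⟩ := h p hpS
  have hle := view_mono (loc := loc) (Set.singleton_subset_iff.2 hpS) w' r
  rw [projEq_of_normalForm_eq_append hloc hx r, projEq_of_normalForm_eq_append hloc hu r,
    proj_append, proj_append, List.append_cancel_left_eq] at hr
  rwa [projEq_of_normalForm_eq_append hloc hx' r, projEq_of_normalForm_eq_append hloc hu' r,
    proj_append, proj_append, List.prefix_append_right_inj, ← hr] at hle

variable (hloc : ∀ a, (loc a).Nonempty) (hA : A.Diamond (Indep loc)) (hfair : A.IsFair loc k)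

include hloc hA hfair

/-- A new letter can disturb only the last k-1 letters of the normal form of `s`, so `z` and `z'`
survive and only the common suffix is rearranged. -/
theorem SuffixEquiv.concat {s t : List α} (h : SuffixEquiv loc A k s t) {a : α}
    (hs : A.IsUseful (s ++ [a])) : SuffixEquiv loc A k (s ++ [a]) (t ++ [a]) := by
  have ht : A.IsUseful (t ++ [a]) :=
    (NFA.isUseful_congr (h.eval_append_eq hloc hA [a])).1 hs
  obtain ⟨z, z', y, hzs, hzt, hz, hlen⟩ := h
  have key : ∀ {s z : List α}, A.IsUseful (s ++ [a]) → normalForm loc s = z ++ y →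
      (z = [] ∨ 2 * (k - 1) ≤ y.length) → ∃ x, normalForm loc (s ++ [a]) = z ++ x ∧
        ProjEq loc x (y ++ [a]) := by
    intro s z hs hzs hzy
    have hl := length_normalForm hloc s
    rw [hzs, List.length_append] at hl
    have htake := hs.of_append.take_normalForm_eq hloc hA hfair (projLE_append s [a])
      (i := z.length) (by
        rcases hzy with rfl | h
        · exact Nat.zero_le _
        · omega)
    rw [hzs, List.take_left] at htake
    have hx : normalForm loc (s ++ [a]) = z ++ (normalForm loc (s ++ [a])).drop z.length := by
      conv_lhs => rw [← List.take_append_drop z.length (normalForm loc (s ++ [a])), htake]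
    refine ⟨_, hx, ProjEq.append_left_cancel (u := z) ?_⟩
    have h1 := projEq_of_normalForm_eq_append hloc hx
    have h2 := (projEq_of_normalForm_eq_append hloc hzs).append (ProjEq.refl (loc := loc) [a])
    rw [List.append_assoc] at h2
    exact h1.symm.trans h2
  obtain ⟨x, hx, hxy⟩ := key hs hzs (hlen.imp And.left And.left)
  obtain ⟨x', hx', hxy'⟩ := key ht hzt (hlen.imp And.right And.left)
  obtain rfl := eq_of_normalForm_eq_append hloc hx hx' (hxy.trans hxy'.symm)
  refine ⟨z, z', x, hx, hx', hz, hlen.imp_right fun h => ⟨?_, h.2⟩⟩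
  have := hxy.length_eq hloc
  simp at this
  omega

/-- The join of useful views is determined, up to `SuffixEquiv`, by the views. -/
theorem suffixEquiv_view (hk : 1 ≤ k) [Finite P] {S : Set P} (hS : S.Nonempty) {w w' : List α}
    (hw : ∀ p ∈ S, A.IsUseful (view loc {p} w))
    (h : ∀ p ∈ S, SuffixEquiv loc A k (view loc {p} w) (view loc {p} w')) :
    SuffixEquiv loc A k (view loc S w) (view loc S w') := by
  have hw' : ∀ p ∈ S, A.IsUseful (view loc {p} w') := fun p hp =>
    (NFA.isUseful_congr ((h p hp).eval_eq hloc hA)).1 (hw p hp)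
  obtain ⟨p₀, hp₀, hmin⟩ := Set.exists_min_image S (fun p => (view loc {p} w).length)
    (Set.toFinite S) hS
  -- The differences to the length of the view of `p₀`, in `w` and in `w'`, are congruent modulo 2k
  -- and less than k in absolute value, hence equal. So `p₀` has a shortest view in `w'` too.
  have hdiff : ∀ p ∈ S, (view loc {p} w).length + (view loc {p₀} w').length =
      (view loc {p} w').length + (view loc {p₀} w).length := by
    intro p hp
    have a1 := (hw p hp).length_view_lt hloc hA hfair (r := p₀)
    have a2 := (hw p₀ hp₀).length_view_lt hloc hA hfair (r := p)
    have a3 := (hw' p hp).length_view_lt hloc hA hfair (r := p₀)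
    have a4 := (hw' p₀ hp₀).length_view_lt hloc hA hfair (r := p)
    have e1 := (h p hp).length_mod_eq hloc
    have e2 := (h p₀ hp₀).length_mod_eq hloc
    have e3 : ((view loc {p} w).length + (view loc {p₀} w').length) ≡
      ((view loc {p} w').length + (view loc {p₀} w).length) [MOD (2 * k)] :=
      Nat.ModEq.add e1 e2.symm
    rcases le_total ((view loc {p} w).length + (view loc {p₀} w').length)
      ((view loc {p} w').length + (view loc {p₀} w).length) with hle | hle
    · have := (Nat.modEq_iff_dvd' hle).1 e3
      have := Nat.eq_zero_of_dvd_of_lt this (by omega)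
      omega
    · have := (Nat.modEq_iff_dvd' hle).1 e3.symm
      have := Nat.eq_zero_of_dvd_of_lt this (by omega)
      omega
  obtain ⟨z, z', y, hz, hz', hzz, hlen⟩ := h p₀ hp₀
  have hl := length_normalForm hloc (view loc {p₀} w)
  have hl' := length_normalForm hloc (view loc {p₀} w')
  rw [hz, List.length_append] at hl
  rw [hz', List.length_append] at hl'
  set v := y.take (y.length - (k - 1)) with hv
  have hvl : v.length = y.length - (k - 1) := by simp [hv]
  have hyv : y = v ++ y.drop (y.length - (k - 1)) := by simp [hv]
  have key : ∀ {w z : List α}, (∀ p ∈ S, A.IsUseful (view loc {p} w)) →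
      normalForm loc (view loc {p₀} w) = z ++ y →
      (∀ p ∈ S, z.length + y.length ≤ (view loc {p} w).length) →
      (z = [] ∨ 2 * (k - 1) ≤ y.length) →
      (∃ x, normalForm loc (view loc S w) = z ++ v ++ x) ∧
        ∀ p ∈ S, ∃ x, normalForm loc (view loc {p} w) = z ++ v ++ x := by
    intro w z hw hz hmin hzy
    have htake : ∀ p ∈ S, (normalForm loc (view loc S w)).take (z ++ v).length =
        (normalForm loc (view loc {p} w)).take (z ++ v).length := by
      intro p hp
      refine (hw p hp).take_normalForm_eq hloc hA hfair
        (view_mono (Set.singleton_subset_iff.2 hp) w) ?_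
      have := hmin p hp
      rw [List.length_append]
      rcases hzy with rfl | h
      · simp at this ⊢; omega
      · omega
    have h0 : (normalForm loc (view loc S w)).take (z ++ v).length = z ++ v := by
      rw [htake p₀ hp₀, hz, hyv, ← List.append_assoc, List.take_left]
    refine ⟨⟨_, (h0 ▸ List.take_append_drop (z ++ v).length (normalForm loc (view loc S w))).symm⟩,
      fun p hp => ?_⟩
    have h1 := (htake p hp).symm.trans h0
    exact ⟨_, (h1 ▸ List.take_append_drop (z ++ v).length
      (normalForm loc (view loc {p} w))).symm⟩
  obtain ⟨⟨x, hx⟩, hp⟩ := key hw hz (fun p hp => hl ▸ hmin p hp)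
    (hlen.imp And.left And.left)
  obtain ⟨⟨x', hx'⟩, hp'⟩ := key hw' hz' (fun p hp => by
    have := hmin p hp
    have := hdiff p hp
    beta_reduce at *
    omega) (hlen.imp And.right And.left)
  have hsuf : ∀ p ∈ S, ∃ u, normalForm loc (view loc {p} w) = z ++ v ++ u ∧
      normalForm loc (view loc {p} w') = z' ++ v ++ u := by
    intro p hpS
    obtain ⟨u, hu⟩ := hp p hpS
    obtain ⟨u', hu'⟩ := hp' p hpS
    have e1 := length_normalForm hloc (view loc {p} w)
    have e2 := length_normalForm hloc (view loc {p} w')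
    rw [hu] at e1
    rw [hu'] at e2
    simp only [List.length_append] at e1 e2
    have e3 := hdiff p hpS
    have e4 := (hw p hpS).length_view_lt hloc hA hfair (r := p₀)
    -- The length of `u` is at most 2(k-1): k-1 for the letters cut from `y`, and k-1 for the excess
    -- over the shortest view.
    have huu := (h p hpS).suffix_eq hu hu' (by omega) (by omega)
    exact ⟨u, hu, huu ▸ hu'⟩
  have hxx : ProjEq loc x x' := fun r =>
    (proj_join_prefix hloc hS hx hx' hsuf r).eq_of_length_le
      (proj_join_prefix hloc hS hx' hx (fun p hpS => (hsuf p hpS).imp fun _ => And.symm) r).length_le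
  obtain rfl := eq_of_normalForm_eq_append hloc hx hx' hxx
  refine ⟨z, z', v ++ x, by rw [hx, List.append_assoc], by rw [hx', List.append_assoc], hzz,
    hlen.imp_right fun h => ⟨?_, h.2⟩⟩
  have h1 := (view_mono (Set.singleton_subset_iff.2 hp₀) w).length_le hloc
  have h2 := length_normalForm hloc (view loc S w)
  rw [hx] at h2
  simp only [List.length_append] at h2 ⊢
  omega

end FairAutomata

/-! ### Local states -/

section LocalStates

variable {α : Type u} {P : Type v} {Q : Type w} {loc : α → Set P} {A : NFA α Q}

theorem NFA.IsDeterministic.eval_subsingleton (h : A.IsDeterministic) (u : List α) :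
    (A.eval u).Subsingleton := by
  induction u using List.reverseRecOn with
  | nil =>
    obtain ⟨q₀, hq₀⟩ := h.1
    simp [hq₀]
  | append_singleton u a ih =>
    intro q hq q' hq'
    rw [NFA.eval_append_singleton, NFA.mem_stepSet] at hq hq'
    obtain ⟨p, hp, hpq⟩ := hq
    obtain ⟨p', hp', hpq'⟩ := hq'
    obtain rfl := ih hp hp'
    exact h.2 p a hpq hpq'

/-- The local states that suffice for a `k`-fair automaton: a counter, a state, and a word. -/
abbrev LocalCode (α : Type u) (Q : Type w) (k : ℕ) : Type (max u w) :=
  Option (Fin (2 * (k - 1) + 2 * k) × Q × (Fin (2 * (k - 1)) → α))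

/-- The number `l`, exactly below `2 * (k - 1)` and modulo `2 * k` from there on. -/
def lengthCode {k : ℕ} (hk : 1 ≤ k) (l : ℕ) : Fin (2 * (k - 1) + 2 * k) :=
  if h : l < 2 * (k - 1) then ⟨l, by omega⟩
  else ⟨2 * (k - 1) + l % (2 * k), by have := Nat.mod_lt l (show 0 < 2 * k by omega); omega⟩

theorem lengthCode_eq {k : ℕ} (hk : 1 ≤ k) {l l' : ℕ} (h : lengthCode hk l = lengthCode hk l') :
    l = l' ∨ 2 * (k - 1) ≤ l ∧ 2 * (k - 1) ≤ l' ∧ l % (2 * k) = l' % (2 * k) := by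
  unfold lengthCode at h
  split_ifs at h <;> simp only [Fin.mk.injEq] at h <;> omega

theorem lengthCode_eq_of_mod_eq {k : ℕ} (hk : 1 ≤ k) {l l' : ℕ} (hl : 2 * (k - 1) ≤ l)
    (hl' : 2 * (k - 1) ≤ l') (h : l % (2 * k) = l' % (2 * k)) :
    lengthCode hk l = lengthCode hk l' := by
  simp [lengthCode, hl.not_gt, hl'.not_gt, h]

variable [LinearOrder α] [Nonempty α] [Nonempty Q]

open Classical in
/-- For useful words, the length of the normal form, its last `2 * (k - 1)` letters, and
the state that is reached before them. -/
noncomputable def localCode (loc : α → Set P) (A : NFA α Q) {k : ℕ} (hk : 1 ≤ k) (w : List α) :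
    LocalCode α Q k :=
  if A.IsUseful w then
    some (lengthCode hk (normalForm loc w).length,
      Classical.epsilon
        (· ∈ A.eval ((normalForm loc w).take ((normalForm loc w).length - 2 * (k - 1)))),
      fun i => ((normalForm loc w).drop ((normalForm loc w).length - 2 * (k - 1))).getD i
        (Classical.arbitrary α))
  else none

variable {k : ℕ} (hk : 1 ≤ k)

theorem localCode_eq_none_iff {w : List α} :
    localCode loc A hk w = none ↔ ¬ A.IsUseful w := by
  simp [localCode]

/-- Padding short words with a default letter loses nothing once their lengths agree, which is why
`lengthCode` is exact for small values. -/
theorem List.eq_of_getD_eq {β : Type*} {n : ℕ} {l l' : List β} (d : β) (hl : l.length = l'.length)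
    (hn : l.length ≤ n) (h : ∀ i : Fin n, l.getD i d = l'.getD i d) : l = l' := by
  refine List.ext_getElem hl fun i h1 h2 => ?_
  simpa [List.getD_eq_getElem?_getD, h1, h2] using h ⟨i, by omega⟩

theorem suffixEquiv_of_localCode_eq (hloc : ∀ a, (loc a).Nonempty) (hA : A.Diamond (Indep loc))
    (hdet : A.IsDeterministic) {s t : List α} (hs : A.IsUseful s)
    (h : localCode loc A hk s = localCode loc A hk t) : SuffixEquiv loc A k s t := by
  have ht : A.IsUseful t := by
    by_contra ht
    rw [(localCode_eq_none_iff hk).2 ht, localCode_eq_none_iff hk] at h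
    exact h hs
  have heps : ∀ {s : List α}, A.IsUseful s → ∀ i, Classical.epsilon
      (· ∈ A.eval ((normalForm loc s).take i)) ∈ A.eval ((normalForm loc s).take i) := by
    intro s hs i
    rw [NFA.isUseful_congr ((projEq_normalForm hloc s).eval_eq hloc hA),
      ← List.take_append_drop i (normalForm loc s)] at hs
    exact Classical.epsilon_spec (hs.of_append.imp fun q hq => hq.1)
  have h1 := heps hs ((normalForm loc s).length - 2 * (k - 1))
  have h2 := heps ht ((normalForm loc t).length - 2 * (k - 1))
  simp only [localCode, if_pos hs, if_pos ht, Option.some.injEq, Prod.mk.injEq] at h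
  obtain ⟨hl, hq, hd⟩ := h
  have hl := lengthCode_eq hk hl
  rw [hq] at h1
  have hdrop := List.eq_of_getD_eq (l := (normalForm loc s).drop _) (l' := (normalForm loc t).drop _)
    _ (by simp only [List.length_drop]; omega) (by simp only [List.length_drop]; omega)
    (congrFun hd)
  refine ⟨_, (normalForm loc t).take ((normalForm loc t).length - 2 * (k - 1)), _,
    (List.take_append_drop ((normalForm loc s).length - 2 * (k - 1)) _).symm, ?_, ?_, ?_⟩
  · rw [hdrop, List.take_append_drop]
  -- Both sets of states have at most one element, by determinism, and they share the state stored
  -- in the code.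
  · ext q
    exact ⟨fun h => hdet.eval_subsingleton _ h h1 ▸ h2, fun h => hdet.eval_subsingleton _ h h2 ▸ h1⟩
  · rcases lt_or_ge (normalForm loc s).length (2 * (k - 1)) with h | h
    · left
      have h' : (normalForm loc t).length < 2 * (k - 1) := by omega
      simp [Nat.sub_eq_zero_of_le h.le, Nat.sub_eq_zero_of_le h'.le]
    · right
      have h' : 2 * (k - 1) ≤ (normalForm loc t).length := by omega
      have hm : (normalForm loc s).length ≡ (normalForm loc t).length [MOD (2 * k)] := by
        rcases hl with hl | hl
        · rw [hl]
        · exact hl.2.2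
      refine ⟨by simp only [List.length_drop]; omega, ?_⟩
      rw [List.length_take_of_le (by omega), List.length_take_of_le (by omega)]
      refine Nat.ModEq.add_right_cancel' (2 * (k - 1)) ?_
      rwa [Nat.sub_add_cancel h, Nat.sub_add_cancel h']

theorem SuffixEquiv.localCode_eq (hloc : ∀ a, (loc a).Nonempty) (hA : A.Diamond (Indep loc))
    {s t : List α} (h : SuffixEquiv loc A k s t) :
    localCode loc A hk s = localCode loc A hk t := by
  have huse := NFA.isUseful_congr (h.eval_eq hloc hA)
  by_cases hu : A.IsUseful s
  swap
  · rw [(localCode_eq_none_iff hk).2 hu, (localCode_eq_none_iff hk).2 (huse.not.1 hu)]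
  have hu' := huse.1 hu
  obtain ⟨z, z', y, hs, ht, hz, ⟨rfl, rfl⟩ | ⟨hy, hm⟩⟩ := h
  · simp [localCode, hu, hu', hs, ht]
  · have hsub : ∀ x : List α, (x ++ y).length - 2 * (k - 1) =
        x.length + (y.length - 2 * (k - 1)) := by
      intro x
      rw [List.length_append]
      omega
    have hc : lengthCode hk (z ++ y).length = lengthCode hk (z' ++ y).length := by
      apply lengthCode_eq_of_mod_eq
      · rw [List.length_append]; omega
      · rw [List.length_append]; omega
      · rw [List.length_append, List.length_append]
        exact Nat.ModEq.add_right _ hm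
    simp only [localCode, if_pos hu, if_pos hu', hs, ht, hc, hsub, List.take_length_add_append,
      List.drop_length_add_append, NFA.eval_append_word, hz]

theorem localCode_view_concat (hloc : ∀ a, (loc a).Nonempty) (hA : A.Diamond (Indep loc))
    (hdet : A.IsDeterministic) (hfair : A.IsFair loc k) [Finite P] {w w' : List α} {a : α}
    (h : ∀ p ∈ loc a, localCode loc A hk (view loc {p} w) = localCode loc A hk (view loc {p} w')) :
    localCode loc A hk (view loc (loc a) w ++ [a]) =
      localCode loc A hk (view loc (loc a) w' ++ [a]) := by
  -- A view that is not useful spoils every larger one, so the code `none` propagates.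
  have hbot : ∀ {w : List α} {p : P}, p ∈ loc a →
      localCode loc A hk (view loc {p} w) = none →
      localCode loc A hk (view loc (loc a) w ++ [a]) = none := by
    intro w p hp hn
    rw [localCode_eq_none_iff] at hn ⊢
    exact fun hu => hn (hu.of_append.of_le hloc hA (view_mono (Set.singleton_subset_iff.2 hp) w))
  by_cases hall : ∀ p ∈ loc a, A.IsUseful (view loc {p} w)
  · have hT := suffixEquiv_view hloc hA hfair hk (hloc a) hall
      fun p hp => suffixEquiv_of_localCode_eq hk hloc hA hdet (hall p hp) (h p hp)
    by_cases hu : A.IsUseful (view loc (loc a) w ++ [a])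
    · exact (hT.concat hloc hA hfair hu).localCode_eq hk hloc hA
    · have hu' := hu
      rw [NFA.isUseful_congr (hT.eval_append_eq hloc hA [a])] at hu'
      rw [(localCode_eq_none_iff hk).2 hu, (localCode_eq_none_iff hk).2 hu']
  · push Not at hall
    obtain ⟨p, hp, hn⟩ := hall
    rw [← localCode_eq_none_iff hk] at hn
    rw [hbot hp hn, hbot hp ((h p hp).symm.trans hn)]

theorem mem_accepts_of_localCode_eq (hloc : ∀ a, (loc a).Nonempty) (hA : A.Diamond (Indep loc))
    (hdet : A.IsDeterministic) (hfair : A.IsFair loc k) [Finite P] [Nonempty P] {w w' : List α}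
    (h : ∀ p, localCode loc A hk (view loc {p} w) = localCode loc A hk (view loc {p} w'))
    (hw : w ∈ A.accepts) : w' ∈ A.accepts := by
  have huse := NFA.isUseful_of_mem_accepts hw
  have hall : ∀ p ∈ Set.univ, A.IsUseful (view loc {p} w) :=
    fun p _ => huse.of_le hloc hA (view_le {p} w)
  have hT := suffixEquiv_view hloc hA hfair hk Set.univ_nonempty hall
    fun p hp => suffixEquiv_of_localCode_eq hk hloc hA hdet (hall p hp) (h p)
  have heval := hT.eval_eq hloc hA
  rw [(view_univ w).eval_eq hloc hA, (view_univ w').eval_eq hloc hA] at heval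
  obtain ⟨f, hf, hfw⟩ := hw
  exact ⟨f, hf, heval ▸ hfw⟩

end LocalStates

/-! ### Asynchronous automata from codes of views -/

/-- If the code of a new view depends only on the codes of the views it joins, and membership in
`L` only on the codes of the views of all processes, then the codes are the local states of an
asynchronous automaton for `L`. -/
theorem exists_asyncAutomaton_of_code {α : Type u} {P : Type v} {X : Type x} (loc : α → Set P)
    (L : Language α) (code : List α → X)
    (hstep : ∀ (w w' : List α) (a : α),
      (∀ p ∈ loc a, code (view loc {p} w) = code (view loc {p} w')) →
        code (view loc (loc a) w ++ [a]) = code (view loc (loc a) w' ++ [a]))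
    (hL : ∀ w w' : List α, (∀ p, code (view loc {p} w) = code (view loc {p} w')) →
      w ∈ L → w' ∈ L) :
    ∃ B : AsyncAutomaton.{u, v, x} loc, (∀ p, B.State p = X) ∧ B.toDFA.accepts = L := by
  classical
  let B : AsyncAutomaton.{u, v, x} loc :=
    { State := fun _ => X
      step := fun a f =>
        -- Any word that explains the local states will do, by `hstep`. The value `f` in the other
        -- case is never met on a run.
        if h : ∃ w, ∀ r : loc a, f r = code (view loc {(r : P)} w) then
          fun _ => code (view loc (loc a) h.choose ++ [a])
        else f
      start := fun _ => code []
      accept := {f | ∃ w ∈ L, ∀ p, f p = code (view loc {p} w)} }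
  have heval : ∀ w, B.toDFA.eval w = fun p => code (view loc {p} w) := by
    intro w
    induction w using List.reverseRecOn with
    | nil => rfl
    | append_singleton w a ih =>
      rw [DFA.eval_append_singleton, ih]
      funext p
      by_cases hp : p ∈ loc a
      · have h : ∃ w', ∀ r : loc a, code (view loc {(r : P)} w) = code (view loc {(r : P)} w') :=
          ⟨w, fun _ => rfl⟩
        simp only [AsyncAutomaton.toDFA, B, dif_pos hp, dif_pos h, view_singleton_concat hp]
        exact (hstep w _ a fun r hr => h.choose_spec ⟨r, hr⟩).symm
      · simp only [AsyncAutomaton.toDFA, dif_neg hp, view_singleton_concat_of_notMem hp]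
  refine ⟨B, fun _ => rfl, ?_⟩
  ext w
  rw [DFA.mem_accepts, heval]
  exact ⟨fun ⟨w', hw', h⟩ => hL w' w (fun p => (h p).symm) hw', fun h => ⟨w, h, fun _ => rfl⟩⟩

theorem card_localCode_le {α : Type u} {Q : Type w} [Finite α] [Nonempty α] [Finite Q] [Nonempty Q]
    {k : ℕ} (hk : 1 ≤ k) :
    Nat.card (LocalCode α Q k) ≤ 4 * (Nat.card Q * k * Nat.card α ^ (3 * k - 3)) := by
  have hα : 0 < Nat.card α := Nat.card_pos
  have hQ : 0 < Nat.card Q := Nat.card_pos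
  have hpow : Nat.card α ^ (2 * (k - 1)) ≤ Nat.card α ^ (3 * k - 3) :=
    Nat.pow_le_pow_right hα (by omega)
  have hpos : 0 < Nat.card Q * Nat.card α ^ (3 * k - 3) := by positivity
  rw [LocalCode, Finite.card_option, Nat.card_prod, Nat.card_prod, Nat.card_fun, Nat.card_fin,
    Nat.card_fin]
  -- The construction needs only the exponent 2k-2. The summand 1 counts `none`.
  calc (2 * (k - 1) + 2 * k) * (Nat.card Q * Nat.card α ^ (2 * (k - 1))) + 1
      ≤ (2 * (k - 1) + 2 * k) * (Nat.card Q * Nat.card α ^ (3 * k - 3)) +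
          Nat.card Q * Nat.card α ^ (3 * k - 3) := by gcongr; exact hpos
    _ = (2 * (k - 1) + 2 * k + 1) * (Nat.card Q * Nat.card α ^ (3 * k - 3)) := by ring
    _ ≤ (4 * k) * (Nat.card Q * Nat.card α ^ (3 * k - 3)) := by gcongr; omega
    _ = 4 * (Nat.card Q * k * Nat.card α ^ (3 * k - 3)) := by ring

theorem mainTheorem1 :
    ∃ C : ℕ, ∀ (α : Type u) (P : Type v) (Q : Type w) [Finite α] [Nonempty α] [Finite P] [Finite Q]
      (loc : α → Set P) (_ : ∀ a, (loc a).Nonempty) (k : ℕ) (_ : 1 ≤ k)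
      (A : NFA α Q) (_ : A.IsDeterministic) (_ : A.Diamond (Indep loc)) (_ : A.IsFair loc k),
      ∃ B : AsyncAutomaton.{u, v, 0} loc,
        B.IsFinite ∧
        traceLanguage (Indep loc) A.accepts = traceLanguage (Indep loc) B.toDFA.accepts ∧
        ∀ p, Nat.card (B.State p) ≤ C * (Nat.card Q * k * Nat.card α ^ (3 * k - 3)) := by
  refine ⟨4, fun α P Q _ _ _ _ loc hloc k hk A hdet hA hfair => ?_⟩
  let : LinearOrder α := LinearOrder.lift' (Finite.equivFin α) (Finite.equivFin α).injective
  have : Nonempty Q := hdet.1.nonempty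
  have : Nonempty P := ⟨(hloc (Classical.arbitrary α)).some⟩
  -- Renaming the codes by numbers puts the local states in universe 0.
  let e := Finite.equivFin (LocalCode α Q k)
  obtain ⟨B, hB, hacc⟩ := exists_asyncAutomaton_of_code loc A.accepts
    (fun w => e (localCode loc A hk w))
    (fun w w' a h => congrArg e (localCode_view_concat hk hloc hA hdet hfair
      fun p hp => e.injective (h p hp)))
    (fun w w' h => mem_accepts_of_localCode_eq hk hloc hA hdet hfair fun p => e.injective (h p))
  refine ⟨B, fun p => hB p ▸ inferInstance, by rw [hacc], fun p => ?_⟩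
  rw [hB p, Nat.card_fin]
  exact card_localCode_le hk
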